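/- Let $n\ge 1$, $\sigma>0$, $s,s^{\mathrm{ref}}\in\mathbb R^n$, and let $X=s+\varepsilon$, $X^{\mathrm{ref}}=s^{\mathrm{ref}}+\varepsilon^{\mathrm{ref}}$, where $\varepsilon,\varepsilon^{\mathrm{ref}}\sim N(0,\sigma^2I_n)$ are independent. Let $\mathcal A:\mathbb R^n\to\mathbb R^n$ be a measurable saliency map, $\tau\in\mathbb R$, and for $x\in\mathbb R^n$ let $\mathcal M_x=\{i\in\{1,\dots,n\}:\mathcal A_i(x)\ge\tau\}$ be the salient region. Let $M=\mathcal M_{\mathrm{obs}}\subseteq\{1,\dots,n\}$ be nonempty with $\mathbb P(\mathcal M_X=M)>0$. Write $W=\binom{X}{X^{\mathrm{ref}}}\in\mathbb R^{2n}$ and let $\mathbf 1_M\in\mathbb R^n$ be the indicator vector of $M$. For $w\in\mathbb R^{2n}$ let $w_{1:n}$ be its first $n$ coordinates. For nonempty $M'\subseteq\{1,\dots,n\}$ put $$\eta_{M'}=\frac1{|M'|}\binom{\mathbf 1_{M'}}{-\mathbf 1_{M'}},\qquad P_{M'}=\frac12\begin{pmatrix}\operatorname{diag}\mathbf 1_{M'}&-\operatorname{diag}\mathbf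 1_{M'}\\-\operatorname{diag}\mathbf 1_{M'}&\operatorname{diag}\mathbf 1_{M'}\end{pmatrix}.$$ Consider one of the following two tests. * Mean null test. $H_0$: $\frac1{|M|}\sum_{i\in M}s_i=\frac1{|M|}\sum_{i\in M}s^{\mathrm{ref}}_i$. The statistic is $T=\eta_{\mathcal M_X}^\top W$ and the nuisance statistic is $\mathcal Q=\bigl(I_{2n}-\eta_{\mathcal M_X}\eta_{\mathcal M_X}^\top/\|\eta_{\mathcal M_X}\|^2\bigr)W$. Put $a=\mathcal Q$, $b=\eta_M/\|\eta_M\|^2$ and let $\nu=N(0,\sigma^2\|\eta_M\|^2)$. * Global null test. $H_0$: $s_i=s^{\mathrm{ref}}_i$ for all $i\in M$. The statistic is $T=\sigma^{-1}\|P_{\mathcal M_X}W\|$ and the nuisance statistic is $\mathcal Q=(\mathcal V,\mathcal U)$ with $\mathcal V=\sigma P_{\mathcal M_X}W/\|P_{\mathcal M_X}W\|$ and $\mathcal U=(I_{2n}-P_{\mathcal M_X})W$. Put $a=\mathcal U$, $b=\mathcal V$ and let $\nu$ be the $\chi$ distribution with $|M|=\operatorname{Trace}(P_M)$ degrees of freedom.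 The selective $p$-value at an observation is $$p_{\mathrm{selective}}=\mathbb P_{H_0}\bigl(|T|\ge|T_{\mathrm{obs}}|\ \big|\ \mathcal M_X=\mathcal M_{\mathrm{obs}},\ \mathcal Q=\mathcal Q_{\mathrm{obs}}\bigr),$$ where the subscript $\mathrm{obs}$ denotes observed values and conditioning on $\mathcal Q=\mathcal Q_{\mathrm{obs}}$ is in the sense of the regular conditional distribution of $T$ given $\mathcal Q$ under $\mathbb P(\,\cdot\mid\mathcal M_X=\mathcal M_{\mathrm{obs}})$. For each of the two tests, if its $H_0$ holds, then: 1. Almost surely under $\mathbb P(\,\cdot\mid\mathcal M_X=M)$, the conditional distribution of $T$ given $\mathcal M_X=M$ and $\mathcal Q$ is $\nu$ truncated to (that is, conditioned on) the set $\mathcal Z=\{z\in\mathbb R:\mathcal M_{a_{1:n}+b_{1:n}z}=M\}$. This is a truncated normal distribution for the mean null test and a truncated $\chi$ distribution for the global null test. 2. For every $\alpha\in[0,1]$, $\ \mathbb P_{H_0}\bigl(p_{\mathrm{selective}}\le\alpha\mid\mathcal M_X=M\bigr)=\alpha$. -/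

import Mathlib

open MeasureTheory ProbabilityTheory

noncomputable section

namespace SelectiveInference

/-- Inputs in `ℝⁿ`, with the Euclidean norm. -/
abbrev Input (n : ℕ) := EuclideanSpace ℝ (Fin n)

/-- Stacked pairs `(X; Xref)` in `ℝ²ⁿ`, with the Euclidean norm; the left summand of the index set
carries the query input and the right summand the reference input. -/
abbrev Stacked (n : ℕ) := EuclideanSpace ℝ (Fin n ⊕ Fin n)

variable {n : ℕ}

/-- The stacked vector `(x; y)`. -/
def stack (x y : Input n) : Stacked n := WithLp.toLp 2 (Sum.elim x y)

/-- The first `n` coordinates of a stacked vector. -/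
def queryPart (w : Stacked n) : Input n := WithLp.toLp 2 (fun i => w (Sum.inl i))

/-- The salient region: the coordinates whose saliency value is at least the threshold `τ`. -/
def salientRegion (A : Input n → Input n) (τ : ℝ) (x : Input n) : Finset (Fin n) :=
  Finset.univ.filter (fun i => τ ≤ A x i)

/-! ### Null hypotheses on a region -/

/-- Mean null hypothesis: the two signals have the same average on `M`. -/
def MeanNull (s sref : Input n) (M : Finset (Fin n)) : Prop :=
  (1 / (M.card : ℝ)) * ∑ i ∈ M, s i = (1 / (M.card : ℝ)) * ∑ i ∈ M, sref i

/-- Global null hypothesis: the two signals agree on `M`. -/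
def GlobalNull (s sref : Input n) (M : Finset (Fin n)) : Prop :=
  ∀ i ∈ M, s i = sref i

/-! ### The mean null test -/

/-- The vector `η_M = |M|⁻¹ (1_M; -1_M)`. -/
def eta (M : Finset (Fin n)) : Stacked n :=
  WithLp.toLp 2 (Sum.elim (fun i => if i ∈ M then 1 / (M.card : ℝ) else 0)
    (fun i => if i ∈ M then -(1 / (M.card : ℝ)) else 0))

/-- The linear test statistic `η_Mᵀ w` on a fixed region. -/
def linStat (M : Finset (Fin n)) (w : Stacked n) : ℝ := inner ℝ (eta M) w

/-- The nuisance component `(I - η_M η_Mᵀ / ‖η_M‖²) w` on a fixed region. -/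
def linNuisance (M : Finset (Fin n)) (w : Stacked n) : Stacked n :=
  w - (inner ℝ (eta M) w / ‖eta M‖ ^ 2) • eta M

/-- The test statistic of the mean null test; the region is the data-driven salient region. -/
def meanStat (A : Input n → Input n) (τ : ℝ) (x xref : Input n) : ℝ :=
  linStat (salientRegion A τ x) (stack x xref)

/-- The nuisance statistic `Q = Ω` of the mean null test. -/
def meanNuisance (A : Input n → Input n) (τ : ℝ) (x xref : Input n) : Stacked n :=
  linNuisance (salientRegion A τ x) (stack x xref)

/-! ### The global null test -/

/-- The projection matrix `P_M = ½ [[diag 1_M, -diag 1_M], [-diag 1_M, diag 1_M]]`. -/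
def projMatrix (M : Finset (Fin n)) : Matrix (Fin n ⊕ Fin n) (Fin n ⊕ Fin n) ℝ :=
  let D : Matrix (Fin n) (Fin n) ℝ := Matrix.diagonal (fun i => if i ∈ M then 1 else 0)
  (1 / 2 : ℝ) • Matrix.fromBlocks D (-D) (-D) D

/-- The trace of `P_M`, which is the number of degrees of freedom in the global null test. -/
theorem trace_projMatrix (M : Finset (Fin n)) : (projMatrix M).trace = M.card := by
  simp [projMatrix, Matrix.trace, Fintype.sum_sum_type, Finset.sum_ite_mem]
  ring

/-- `P_M w`. -/
def proj (M : Finset (Fin n)) (w : Stacked n) : Stacked n :=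
  Matrix.toEuclideanCLM (𝕜 := ℝ) (projMatrix M) w

/-- The test statistic `σ⁻¹ ‖P_M (X; Xref)‖` of the global null test, at the salient region. -/
def globalStat (σ : ℝ) (A : Input n → Input n) (τ : ℝ) (x xref : Input n) : ℝ :=
  σ⁻¹ * ‖proj (salientRegion A τ x) (stack x xref)‖

/-- `V = σ P_M (X; Xref) / ‖P_M (X; Xref)‖`, at the salient region. -/
def globalDir (σ : ℝ) (A : Input n → Input n) (τ : ℝ) (x xref : Input n) : Stacked n :=
  (σ / ‖proj (salientRegion A τ x) (stack x xref)‖) •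
    proj (salientRegion A τ x) (stack x xref)

/-- `U = (I - P_M) (X; Xref)`, at the salient region. -/
def globalRest (A : Input n → Input n) (τ : ℝ) (x xref : Input n) : Stacked n :=
  stack x xref - proj (salientRegion A τ x) (stack x xref)

/-- The nuisance statistic `Q = (V, U)` of the global null test. -/
def globalNuisance (σ : ℝ) (A : Input n → Input n) (τ : ℝ) (x xref : Input n) :
    Stacked n × Stacked n :=
  (globalDir σ A τ x xref, globalRest A τ x xref)

/-! ### Truncated laws -/

/-- The truncation region of the line `a + b z`: the `z` for which the query part of `a + b z`
has salient region `M`. -/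
def truncationRegion (A : Input n → Input n) (τ : ℝ) (M : Finset (Fin n)) (a b : Stacked n) :
    Set ℝ :=
  {z | salientRegion A τ (queryPart a + z • queryPart b) = M}

/-- The `χ` distribution with `k` degrees of freedom: the law of the Euclidean norm of a standard
Gaussian vector in `ℝᵏ`. -/
def chi (k : ℕ) : Measure ℝ :=
  (stdGaussian (EuclideanSpace ℝ (Fin k))).map (fun z => ‖z‖)

/-! ### Selective p-value -/

section

variable {Ω β : Type*} [MeasurableSpace Ω] [MeasurableSpace β]

/-- The conditional probability measure `P(· | R = M)` given that the selected region is `M`. -/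
def selectedLaw (P : Measure Ω) (R : Ω → Finset (Fin n)) (M : Finset (Fin n)) : Measure Ω :=
  ProbabilityTheory.cond P {ω | R ω = M}

instance (P : Measure Ω) (R : Ω → Finset (Fin n)) (M : Finset (Fin n)) :
    IsFiniteMeasure (selectedLaw P R M) := by
  unfold selectedLaw; infer_instance

/-- The regular conditional distribution of the statistic `T` given that the selected region is `M`
and given the value of the nuisance statistic `Q`. -/
def selectiveLaw (P : Measure Ω) (R : Ω → Finset (Fin n)) (T : Ω → ℝ) (Q : Ω → β)
    (M : Finset (Fin n)) : Kernel β ℝ :=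
  condDistrib T Q (selectedLaw P R M)

/-- The selective p-value at the observation `ω₀`:
`P(|T| ≥ |T ω₀| ∣ R = R ω₀, Q = Q ω₀)`. -/
def selectivePValue (P : Measure Ω) (R : Ω → Finset (Fin n)) (T : Ω → ℝ) (Q : Ω → β)
    (ω₀ : Ω) : ℝ :=
  (selectiveLaw P R T Q (R ω₀) (Q ω₀)).real {t | |T ω₀| ≤ |t|}

/-- The salient region of the random query input. -/
def regionRV (A : Input n → Input n) (τ : ℝ) (X : Ω → Input n) : Ω → Finset (Fin n) :=
  fun ω => salientRegion A τ (X ω)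

/-- The mean-null statistic `T(X, Xref)` as a random variable. -/
def meanT (A : Input n → Input n) (τ : ℝ) (X Xref : Ω → Input n) : Ω → ℝ :=
  fun ω => meanStat A τ (X ω) (Xref ω)

/-- The mean-null nuisance statistic as a random variable. -/
def meanQ (A : Input n → Input n) (τ : ℝ) (X Xref : Ω → Input n) : Ω → Stacked n :=
  fun ω => meanNuisance A τ (X ω) (Xref ω)

/-- The global-null statistic `T(X, Xref)` as a random variable. -/
def globalT (σ : ℝ) (A : Input n → Input n) (τ : ℝ) (X Xref : Ω → Input n) : Ω → ℝ :=
  fun ω => globalStat σ A τ (X ω) (Xref ω)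

/-- The global-null nuisance statistic `(V, U)` as a random variable. -/
def globalQ (σ : ℝ) (A : Input n → Input n) (τ : ℝ) (X Xref : Ω → Input n) :
    Ω → Stacked n × Stacked n :=
  fun ω => globalNuisance σ A τ (X ω) (Xref ω)

end

end SelectiveInference

end

open SelectiveInference

/-!
Fix the region `M` and write `W = (X; Xref) = m + N` with `N` centred Gaussian of covariance
`σ² I`. On the event that the salient region is `M`, both test statistics and nuisance statistics
coincide with their versions computed with the deterministic region `M`, and `W = a + T b` where
`(a, b)` is determined by the nuisance statistic. Three facts then give the theorem.

* *Independence.* For a linear isometry `J` with adjoint `K`, the vectors `K W` and `W - J K W` are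
  independent, because the characteristic function of their joint law factorizes
  (`indepFun_proj_residual`); if `K m = 0`, then `K W / σ` is standard Gaussian
  (`map_inv_smul_proj_eq_stdGaussian`). For the mean null test, `J` parametrizes the line spanned by
  `η_M`. For the global null test, `J` maps `ℝ^M` onto the range of `P_M`, and polar coordinates show
  in addition that the norm and the direction of a standard Gaussian vector are independent
  (`indepFun_norm_direction`). In both cases the statistic `T` for the fixed region is independent of
  the nuisance statistic `Q`, and has law `ν`.
* *Truncation.* The selection event is `(Q, T) ∈ S` for a measurable set `S`. Conditioning a product
  law `μ ⊗ ν` on `S` yields a law whose disintegration over the first coordinate is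
  `q ↦ ν(· | S_q)` (`cond_prod_eq_compProd_truncKernel`).
* *Uniformity.* The truncated law `ν(· | S_q)` has no atoms, hence the two-sided tail probability
  evaluated at a draw from it is uniform on `[0, 1]` (`measure_abs_tail_le`). Integrating over the
  nuisance statistic gives the claim on the p-value; see `truncated_law_and_uniform_pValue`.
-/

namespace SelectiveInference

/-! ### The probability integral transform -/

/-- A distribution function has no jump where the measure has no atom. -/
theorem continuous_cdf (μ : Measure ℝ) [IsProbabilityMeasure μ] [NullSingletonClass μ] :
    Continuous (cdf μ) := by
  refine continuous_iff_continuousAt.2 fun x => ?_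
  rw [(monotone_cdf μ).continuousAt_iff_leftLim_eq_rightLim, StieltjesFunction.rightLim_eq]
  have h : (cdf μ).measure {x} = 0 := by rw [measure_cdf, measure_singleton]
  rw [StieltjesFunction.measure_singleton, ENNReal.ofReal_eq_zero] at h
  exact le_antisymm ((monotone_cdf μ).leftLim_le le_rfl) (by linarith)

/-- Probability integral transform: if `Y` has an atomless law with distribution function `F`, then
`F(Y)` is uniform on `[0, 1]`. -/
theorem measure_cdf_le (μ : Measure ℝ) [IsProbabilityMeasure μ] [NullSingletonClass μ]
    {α : ℝ} (h0 : 0 ≤ α) (h1 : α ≤ 1) : μ {y | cdf μ y ≤ α} = ENNReal.ofReal α := by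
  rcases h1.eq_or_lt with rfl | h1
  · simp [cdf_le_one]
  rcases Set.eq_empty_or_nonempty {y | cdf μ y ≤ α} with hS | hS
  · rw [hS, measure_empty, eq_comm, ENNReal.ofReal_eq_zero]
    by_contra! hα
    obtain ⟨y, hy⟩ := ((tendsto_cdf_atBot μ).eventually_lt_const hα).exists
    exact (Set.eq_empty_iff_forall_notMem.1 hS y) hy.le
  have hbdd : BddAbove {y | cdf μ y ≤ α} := by
    obtain ⟨b, hb⟩ := ((tendsto_cdf_atTop μ).eventually_const_lt h1).exists
    refine ⟨b, fun y hy => ?_⟩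
    by_contra! hlt
    exact absurd (hb.trans_le ((monotone_cdf μ) hlt.le)) (not_lt.2 hy)
  have hmem := (isClosed_le (continuous_cdf μ) continuous_const).csSup_mem hS hbdd
  set c := sSup {y | cdf μ y ≤ α}
  -- The sublevel set is closed, bounded above and downward closed, so it is the ray up to `c`.
  have hIic : {y | cdf μ y ≤ α} = Set.Iic c :=
    Set.ext fun y => ⟨fun hy => le_csSup hbdd hy, fun hy => (monotone_cdf μ hy).trans hmem⟩
  have hc : α ≤ cdf μ c := by
    refine ge_of_tendsto ((continuous_cdf μ).continuousWithinAt (s := Set.Ioi c)) ?_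
    filter_upwards [self_mem_nhdsWithin] with y hy
    exact le_of_not_ge fun h => (not_le.2 hy) (le_csSup hbdd h)
  rw [hIic, ← ofReal_cdf, le_antisymm hmem hc]

/-- The two-sided p-value of an atomless law is uniform: it is the distribution function of `-|t|`
evaluated at `-|t|`. -/
theorem measure_abs_tail_le (μ : Measure ℝ) [IsProbabilityMeasure μ] [NullSingletonClass μ]
    {α : ℝ} (h0 : 0 ≤ α) (h1 : α ≤ 1) :
    μ {t | μ.real {t' | |t| ≤ |t'|} ≤ α} = ENNReal.ofReal α := by
  have hmeas : Measurable fun t : ℝ => -|t| := by fun_prop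
  have : IsProbabilityMeasure (μ.map fun t => -|t|) := Measure.isProbabilityMeasure_map (by fun_prop)
  have : NullSingletonClass (μ.map fun t => -|t|) := by
    refine ⟨fun x => ?_⟩
    rw [Measure.map_apply hmeas (measurableSet_singleton x)]
    refine Set.Finite.measure_zero ((Set.toFinite {x, -x}).subset fun t ht => ?_) _
    have ht' : |t| = -x := by simpa [neg_eq_iff_eq_neg] using ht
    rcases abs_choice t with h | h
    · right; simp only [Set.mem_singleton_iff]; linarith
    · left; linarith
  rw [← measure_cdf_le (μ.map fun t => -|t|) h0 h1,
    Measure.map_apply hmeas ((isClosed_le (continuous_cdf _) continuous_const).measurableSet)]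
  congr 1 with t
  simp [cdf_eq_real, measureReal_def, Measure.map_apply hmeas measurableSet_Iic, Set.preimage]

/-! ### Conditioning a product law on an event -/

section

variable {Ω β : Type*} [MeasurableSpace Ω] [MeasurableSpace β]

/-- The kernel sending `q` to the law `ν` conditioned on the section `{t | (q, t) ∈ S}`. It is the zero
measure at those `q` whose section is `ν`-null, so it is a finite kernel but in general not a Markov
kernel. -/
noncomputable def truncKernel (ν : Measure ℝ) [IsProbabilityMeasure ν] {S : Set (β × ℝ)}
    (hS : MeasurableSet S) : Kernel β ℝ where
  toFun q := ProbabilityTheory.cond ν (Prod.mk q ⁻¹' S)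
  measurable' := by
    refine Measure.measurable_of_measurable_coe _ fun B hB => ?_
    simp_rw [cond_apply (measurable_prodMk_left hS)]
    have := hS.inter (measurable_snd hB)
    exact (measurable_measure_prodMk_left hS).inv.mul (measurable_measure_prodMk_left this)

instance (ν : Measure ℝ) [IsProbabilityMeasure ν] {S : Set (β × ℝ)}
    (hS : MeasurableSet S) : IsFiniteKernel (truncKernel ν hS) :=
  ⟨⟨1, ENNReal.one_lt_top, fun q => prob_le_one (μ := ProbabilityTheory.cond ν (Prod.mk q ⁻¹' S))⟩⟩

/-- A product law conditioned on `S` disintegrates over its first coordinate into the second factor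
conditioned on the sections of `S`. -/
theorem cond_prod_eq_compProd_truncKernel (μ : Measure β) [IsProbabilityMeasure μ] (ν : Measure ℝ)
    [IsProbabilityMeasure ν] {S : Set (β × ℝ)} (hS : MeasurableSet S) :
    ProbabilityTheory.cond (μ.prod ν) S =
      (ProbabilityTheory.cond (μ.prod ν) S).fst ⊗ₘ truncKernel ν hS := by
  -- The first marginal has density `q ↦ ν (S_q)`, which cancels the normalization of `ν(· | S_q)`.
  have hfst : ((μ.prod ν).restrict S).fst = μ.withDensity fun q => ν (Prod.mk q ⁻¹' S) := by
    ext B hB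
    rw [Measure.fst_apply hB, Measure.restrict_apply (measurable_fst hB), withDensity_apply _ hB,
      Measure.prod_apply ((measurable_fst hB).inter hS), ← lintegral_indicator hB]
    congr 1 with q
    by_cases hq : q ∈ B <;> simp [hq, Set.preimage]
  rw [ProbabilityTheory.cond, Measure.fst, Measure.map_smul, Measure.compProd_smul_left,
    ← Measure.fst, hfst]
  congr 1
  ext B hB
  have hSB := measurable_measure_prodMk_left (ν := ν) hS
  rw [Measure.compProd_apply hB,
    lintegral_withDensity_eq_lintegral_mul _ hSB (Kernel.measurable_kernel_prodMk_left hB),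
    Measure.restrict_apply hB, Measure.prod_apply (hB.inter hS)]
  refine lintegral_congr fun q => ?_
  have : truncKernel ν hS q (Prod.mk q ⁻¹' B) =
      (ν (Prod.mk q ⁻¹' S))⁻¹ * ν (Prod.mk q ⁻¹' S ∩ Prod.mk q ⁻¹' B) :=
    cond_apply (measurable_prodMk_left hS) _ _
  rw [Pi.mul_apply, this, Set.preimage_inter, Set.inter_comm]
  by_cases h : ν (Prod.mk q ⁻¹' S) = 0
  · rw [h, zero_mul, measure_inter_null_of_null_left _ h]
  · rw [← mul_assoc, ENNReal.mul_inv_cancel h (measure_ne_top _ _), one_mul]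

/-- If `T` and `Q` are independent, then under conditioning on `(Q, T) ∈ S` the conditional law of `T`
given `Q` is the original law of `T` truncated to the section of `S`. -/
theorem condDistrib_cond_ae_eq {P : Measure Ω} [IsProbabilityMeasure P] {T : Ω → ℝ} {Q : Ω → β}
    (hT : Measurable T) (hQ : Measurable Q) (hind : IndepFun Q T P) {S : Set (β × ℝ)}
    (hS : MeasurableSet S) {ρ : Measure Ω} [IsFiniteMeasure ρ]
    (hρ : ρ = ProbabilityTheory.cond P {ω | (Q ω, T ω) ∈ S}) :
    ∀ᵐ q ∂(ρ.map Q), condDistrib T Q ρ q = ProbabilityTheory.cond (P.map T) (Prod.mk q ⁻¹' S) := by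
  have : IsProbabilityMeasure (P.map T) := Measure.isProbabilityMeasure_map hT.aemeasurable
  have : IsProbabilityMeasure (P.map Q) := Measure.isProbabilityMeasure_map hQ.aemeasurable
  have hjoint : P.map (fun ω => (Q ω, T ω)) = (P.map Q).prod (P.map T) :=
    (indepFun_iff_map_prod_eq_prod_map_map hQ.aemeasurable hT.aemeasurable).1 hind
  have hmap : ρ.map (fun ω => (Q ω, T ω)) =
      ProbabilityTheory.cond ((P.map Q).prod (P.map T)) S := by
    rw [hρ, ← hjoint, ProbabilityTheory.cond, ProbabilityTheory.cond, Measure.map_smul,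
      Measure.map_apply (hQ.prodMk hT) hS, Measure.restrict_map (hQ.prodMk hT) hS]
    rfl
  have h := condDistrib_ae_eq_of_measure_eq_compProd (μ := ρ) Q hT.aemeasurable
    (κ := truncKernel (P.map T) hS) (by
      have hfst : ρ.map Q = (ρ.map fun ω => (Q ω, T ω)).fst := (Measure.fst_map_prodMk hT).symm
      rw [hfst, hmap]
      exact cond_prod_eq_compProd_truncKernel _ _ hS)
  exact h

/-- Selective inference in the abstract. On the selection event the statistic `T` and the nuisance
statistic `Q` agree with `T'` and `Q'`, which are independent without selection, and the selection
event is `(Q', T') ∈ S`. Then the selective law of `T` given `Q` is the law `ν` of `T'` truncated to the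
section of `S` at `Q`, and the selective p-value is uniform. -/
theorem truncated_law_and_uniform_pValue {n : ℕ} {P : Measure Ω} [IsProbabilityMeasure P]
    {R : Ω → Finset (Fin n)} {M : Finset (Fin n)} {T T' : Ω → ℝ} {Q Q' : Ω → β} {ν : Measure ℝ}
    [NullSingletonClass ν] {S : Set (β × ℝ)} (hS : MeasurableSet S)
    (hT' : Measurable T') (hQ' : Measurable Q') (hind : IndepFun Q' T' P) (hν : P.map T' = ν)
    (hTT' : ∀ ω, R ω = M → T ω = T' ω) (hQQ' : ∀ ω, R ω = M → Q ω = Q' ω)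
    (hR : ∀ ω, R ω = M ↔ (Q' ω, T' ω) ∈ S) (hpos : P {ω | R ω = M} ≠ 0) :
    (∀ᵐ ω ∂(selectedLaw P R M), selectiveLaw P R T Q M (Q ω) =
      ProbabilityTheory.cond ν {z | (Q ω, z) ∈ S}) ∧
    ∀ α : ℝ, 0 ≤ α → α ≤ 1 →
      selectedLaw P R M {ω | selectivePValue P R T Q ω ≤ α} = ENNReal.ofReal α := by
  subst hν
  have hset : {ω | R ω = M} = {ω | (Q' ω, T' ω) ∈ S} := Set.ext hR
  have hRmeas : MeasurableSet {ω | R ω = M} := hset ▸ (hQ'.prodMk hT') hS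
  have hprob : IsProbabilityMeasure (selectedLaw P R M) := cond_isProbabilityMeasure hpos
  have hRae : ∀ᵐ ω ∂(selectedLaw P R M), R ω = M := ae_cond_mem hRmeas
  have hTae : T =ᵐ[selectedLaw P R M] T' := hRae.mono hTT'
  have hQae : Q =ᵐ[selectedLaw P R M] Q' := hRae.mono hQQ'
  have hlaw : selectiveLaw P R T Q M = condDistrib T' Q' (selectedLaw P R M) :=
    condDistrib_congr hTae hQae
  have hae := condDistrib_cond_ae_eq hT' hQ' hind hS (ρ := selectedLaw P R M)
    (by rw [selectedLaw, hset])
  set ρ := selectedLaw P R M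
  set κ := condDistrib T' Q' ρ with hκ
  constructor
  · filter_upwards [hQae, ae_of_ae_map hQ'.aemeasurable hae] with ω hω hω'
    rw [hlaw, hω, hω']
    rfl
  · intro α h0 h1
    have hU : MeasurableSet {p : (β × ℝ) × ℝ | |p.1.2| ≤ |p.2|} :=
      measurableSet_le (by fun_prop) (by fun_prop)
    have hpm : Measurable fun p : β × ℝ => (κ p.1).real {t | |p.2| ≤ |t|} :=
      (Kernel.measurable_kernel_prodMk_left (κ := κ.prodMkRight ℝ) hU).ennreal_toReal
    have hB : MeasurableSet {p : β × ℝ | (κ p.1).real {t | |p.2| ≤ |t|} ≤ α} :=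
      measurableSet_le hpm measurable_const
    have hP : ρ {ω | selectivePValue P R T Q ω ≤ α} =
        ρ ((fun ω => (Q' ω, T' ω)) ⁻¹' {p : β × ℝ | (κ p.1).real {t | |p.2| ≤ |t|} ≤ α}) := by
      refine measure_congr ?_
      filter_upwards [hRae, hTae, hQae] with ω h₁ h₂ h₃
      refine propext ?_
      change selectivePValue P R T Q ω ≤ α ↔ (κ (Q' ω)).real {t | |T' ω| ≤ |t|} ≤ α
      rw [selectivePValue, h₁, h₂, h₃, hlaw]
    have : IsProbabilityMeasure (ρ.map Q') := Measure.isProbabilityMeasure_map hQ'.aemeasurable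
    rw [hP, ← Measure.map_apply (hQ'.prodMk hT') hB, ← compProd_map_condDistrib hT'.aemeasurable,
      Measure.compProd_apply hB]
    have hint : ∀ᵐ q ∂(ρ.map Q'), κ q (Prod.mk q ⁻¹' {p : β × ℝ |
        (κ p.1).real {t | |p.2| ≤ |t|} ≤ α}) = ENNReal.ofReal α := by
      filter_upwards [hae] with q hq
      have : NullSingletonClass (κ q) :=
        ⟨fun x => by rw [hq]; exact cond_absolutelyContinuous (measure_singleton x)⟩
      exact measure_abs_tail_le (κ q) h0 h1
    rw [lintegral_congr_ae hint, lintegral_const, measure_univ, mul_one]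

end

/-! ### Norm and direction of a standard Gaussian vector -/

section

variable {E : Type*} [NormedAddCommGroup E] [InnerProductSpace ℝ E] [FiniteDimensional ℝ E]
  [MeasurableSpace E] [BorelSpace E]

open Complex in
/-- The standard Gaussian measure has density `(2π)^(-d/2) exp(-‖x‖²/2)`; the two sides have the same
characteristic function. -/
theorem stdGaussian_eq_withDensity : stdGaussian E = (volume : Measure E).withDensity
    fun x => ENNReal.ofReal ((2 * Real.pi) ^ (-(Module.finrank ℝ E / 2 : ℝ)) *
      Real.exp (-(1 / 2) * ‖x‖ ^ 2)) := by
  set C : ℝ := (2 * Real.pi) ^ (-(Module.finrank ℝ E / 2 : ℝ)) with hC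
  have hC0 : 0 ≤ C := by positivity
  have hint : Integrable (fun x : E => C * Real.exp (-(1 / 2) * ‖x‖ ^ 2)) := by
    have := (GaussianFourier.integrable_cexp_neg_mul_sq_norm_add (V := E) (b := 1 / 2)
      (by norm_num) 0 0).norm.const_mul C
    refine this.congr (ae_of_all _ fun x => ?_)
    simp [Complex.norm_exp, ← Complex.ofReal_pow]
  have : IsFiniteMeasure ((volume : Measure E).withDensity fun x =>
      ENNReal.ofReal (C * Real.exp (-(1 / 2) * ‖x‖ ^ 2))) :=
    isFiniteMeasure_withDensity_ofReal hint.2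
  refine Measure.ext_of_charFun (funext fun t => ?_)
  rw [charFun_stdGaussian, charFun_apply, integral_withDensity_eq_integral_toReal_smul₀ (by fun_prop)
    (ae_of_all _ fun _ => ENNReal.ofReal_lt_top)]
  have h := GaussianFourier.integral_cexp_neg_mul_sq_norm_add (V := E) (b := 1 / 2)
    (by norm_num) I t
  have hcongr : ∀ x : E, (ENNReal.ofReal (C * Real.exp (-(1 / 2) * ‖x‖ ^ 2))).toReal •
      cexp (inner ℝ x t * I) = C * cexp (-(1 / 2) * ‖x‖ ^ 2 + I * inner ℝ t x) := by
    intro x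
    rw [ENNReal.toReal_ofReal (by positivity), Complex.real_smul, Complex.exp_add,
      real_inner_comm]
    push_cast
    rw [mul_assoc, mul_comm I]
  simp_rw [hcongr]
  rw [integral_const_mul, h, ← mul_assoc]
  have h1 : (C : ℂ) * (Real.pi / (1 / 2)) ^ (Module.finrank ℝ E / 2 : ℂ) = 1 := by
    have h2 : (Real.pi / (1 / 2) : ℂ) ^ (Module.finrank ℝ E / 2 : ℂ) =
        (((2 * Real.pi) ^ (Module.finrank ℝ E / 2 : ℝ) : ℝ) : ℂ) := by
      rw [Complex.ofReal_cpow (by positivity)]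
      push_cast
      congr 1
      ring
    rw [h2, ← Complex.ofReal_mul, hC, ← Real.rpow_add (by positivity)]
    simp
  rw [h1, one_mul, I_sq]
  congr 1
  ring

theorem stdGaussian_absolutelyContinuous : stdGaussian E ≪ (volume : Measure E) := by
  rw [stdGaussian_eq_withDensity]
  exact withDensity_absolutelyContinuous _ _

/-- Under a measure with radial density, norm and direction have a joint law of product form, by
integration in polar coordinates. -/
theorem exists_withDensity_norm_apply_eq_mul (μ : Measure E) [μ.IsAddHaarMeasure] [Nontrivial E]
    {g : ℝ → ENNReal} (hg : Measurable g) :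
    ∃ (μr : Measure ℝ) (μd : Measure E), ∀ ⦃A : Set ℝ⦄ ⦃B : Set E⦄, MeasurableSet A →
      MeasurableSet B → μ.withDensity (fun x => g ‖x‖)
        ((fun x => ‖x‖) ⁻¹' A ∩ (fun x => ‖x‖⁻¹ • x) ⁻¹' B) = μr A * μd B := by
  have hdir : Measurable fun x : E => ‖x‖⁻¹ • x := by fun_prop
  set d := Module.finrank ℝ E - 1
  refine ⟨((Measure.volumeIoiPow d).withDensity fun r => g r).map Subtype.val,
    μ.toSphere.map Subtype.val, fun A B hA hB => ?_⟩
  have hms := (measurable_norm (α := E) hA).inter (hdir hB)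
  have hA' := measurable_subtype_coe (p := fun r : ℝ => r ∈ Set.Ioi 0) hA
  have hB' := measurable_subtype_coe (p := fun x : E => x ∈ Metric.sphere 0 1) hB
  have hf : Measurable fun u : Metric.sphere (0 : E) 1 =>
      (Subtype.val ⁻¹' B).indicator (1 : Metric.sphere (0 : E) 1 → ENNReal) u :=
    measurable_one.indicator hB'
  have hh : Measurable fun r : Set.Ioi (0 : ℝ) =>
      (Subtype.val ⁻¹' A).indicator (fun r : Set.Ioi (0 : ℝ) => g r) r :=
    (hg.comp measurable_subtype_coe).indicator hA'
  -- The factor on directions is the sphere measure, the one on radii is `g r * r ^ d dr`.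
  rw [withDensity_apply _ hms, ← lintegral_indicator hms,
    Measure.map_apply measurable_subtype_coe hA, Measure.map_apply measurable_subtype_coe hB,
    withDensity_apply _ hA', ← lintegral_indicator hA', ← lintegral_indicator_one hB',
    mul_comm, ← lintegral_prod_mul hf.aemeasurable hh.aemeasurable]
  refine Eq.trans ?_ (μ.measurePreserving_homeomorphUnitSphereProd.lintegral_comp
    ((hf.comp measurable_fst).mul (hh.comp measurable_snd)))
  rw [← restrict_compl_singleton (μ := μ) 0,
    ← lintegral_subtype_comap (measurableSet_singleton _).compl, restrict_compl_singleton]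
  refine lintegral_congr fun x => ?_
  by_cases h1 : ‖(x : E)‖ ∈ A <;> by_cases h2 : ‖(x : E)‖⁻¹ • (x : E) ∈ B <;>
    simp [Set.indicator, h1, h2]

theorem indepFun_norm_direction [Nontrivial E] :
    IndepFun (fun x : E => ‖x‖) (fun x : E => ‖x‖⁻¹ • x) (stdGaussian E) := by
  have hdir : Measurable fun x : E => ‖x‖⁻¹ • x := by fun_prop
  obtain ⟨μr, μd, h⟩ := exists_withDensity_norm_apply_eq_mul (volume : Measure E)
    (g := fun r => ENNReal.ofReal ((2 * Real.pi) ^ (-(Module.finrank ℝ E / 2 : ℝ)) *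
      Real.exp (-(1 / 2) * r ^ 2))) (by fun_prop)
  rw [← stdGaussian_eq_withDensity] at h
  rw [indepFun_iff_measure_inter_preimage_eq_mul]
  -- The two factors are not normalized individually, but the product of their masses is `1`.
  intro A B hA hB
  have hA' := h hA MeasurableSet.univ
  have hB' := h MeasurableSet.univ hB
  have h1 := h MeasurableSet.univ MeasurableSet.univ
  simp only [Set.preimage_univ, Set.univ_inter, Set.inter_univ, measure_univ] at hA' hB' h1
  rw [h hA hB, hA', hB', mul_mul_mul_comm, mul_comm (μd Set.univ), ← mul_mul_mul_comm, ← h1,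
    mul_one]

end

/-! ### Orthogonal decomposition of a Gaussian vector -/

theorem indepFun_prodMk_right {Ω α β γ : Type*} [MeasurableSpace Ω] [MeasurableSpace α]
    [MeasurableSpace β] [MeasurableSpace γ] {P : Measure Ω} [IsProbabilityMeasure P]
    {X : Ω → α} {Y : Ω → β} {Z : Ω → γ} (hX : Measurable X) (hY : Measurable Y)
    (hZ : Measurable Z) (hXY : IndepFun X Y P) (hXYZ : IndepFun (fun ω => (X ω, Y ω)) Z P) :
    IndepFun X (fun ω => (Y ω, Z ω)) P := by
  have hYZ : IndepFun Y Z P := hXYZ.comp (φ := Prod.snd) (ψ := id) measurable_snd measurable_id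
  have := Measure.isProbabilityMeasure_map (μ := P) hX.aemeasurable
  have := Measure.isProbabilityMeasure_map (μ := P) hY.aemeasurable
  have := Measure.isProbabilityMeasure_map (μ := P) hZ.aemeasurable
  rw [indepFun_iff_map_prod_eq_prod_map_map (by fun_prop) (by fun_prop)] at hXY hXYZ hYZ ⊢
  have h : (fun ω => (X ω, (Y ω, Z ω))) =
      MeasurableEquiv.prodAssoc ∘ fun ω => ((X ω, Y ω), Z ω) := rfl
  rw [h, ← Measure.map_map (by fun_prop) (by fun_prop), hXYZ, hXY, hYZ]
  exact (measurePreserving_prodAssoc _ _ _).map_eq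

section

variable {Ω E F : Type*} [MeasurableSpace Ω]
  [NormedAddCommGroup E] [InnerProductSpace ℝ E] [FiniteDimensional ℝ E]
  [MeasurableSpace E] [BorelSpace E]
  [NormedAddCommGroup F] [InnerProductSpace ℝ F] [FiniteDimensional ℝ F]
  [MeasurableSpace F] [BorelSpace F]

/-- Characteristic function of a linear image, for `v` the value of the adjoint of `L` at `u`. -/
theorem charFun_map_of_adjoint {P : Measure Ω} {N : Ω → E} (hN : Measurable N) {L : E →L[ℝ] F}
    (u : F) (v : E) (h : ∀ w, inner ℝ (L w) u = inner ℝ w v) :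
    charFun (P.map fun ω => L (N ω)) u = charFun (P.map N) v := by
  rw [charFun_apply, charFun_apply, integral_map (by fun_prop) (by fun_prop),
    integral_map (by fun_prop) (by fun_prop)]
  simp_rw [h]

/-- Let `J` be an isometric embedding with adjoint `K`. The `K`-coordinates of an isotropic Gaussian
vector are independent of its component `W - J K W` orthogonal to the range of `J`. -/
theorem indepFun_proj_residual {P : Measure Ω} [IsProbabilityMeasure P] {σ : ℝ} {N W : Ω → E}
    {m : E} (hN : Measurable N)
    (hchar : ∀ t, charFun (P.map N) t = Complex.exp (-(σ ^ 2 * ‖t‖ ^ 2 / 2)))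
    {J : F →L[ℝ] E} {K : E →L[ℝ] F} (hJK : ∀ x w, inner ℝ (J x) w = inner ℝ x (K w))
    (hKJ : ∀ x, K (J x) = x) (hW : ∀ ω, W ω = m + N ω) :
    IndepFun (fun ω => K (W ω)) (fun ω => W ω - J (K (W ω))) P := by
  have key : IndepFun (fun ω => K (N ω)) (fun ω => N ω - J (K (N ω))) P := by
    rw [indepFun_iff_charFun_prod (by fun_prop) (by fun_prop)]
    intro t
    set L : E →L[ℝ] E := ContinuousLinearMap.id ℝ E - J.comp K with hL
    have hKt : ∀ w x, inner ℝ (K w) x = inner ℝ w (J x) := fun w x => by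
      rw [real_inner_comm, ← hJK, real_inner_comm]
    have hLt : ∀ w y, inner ℝ (L w) y = inner ℝ w (L y) := fun w y => by
      simp [hL, inner_sub_left, inner_sub_right, hJK, hKt]
    have horth : ∀ x y, inner ℝ (J x) (L y) = 0 := fun x y => by
      rw [hJK]; simp [hL, hKJ]
    have h1 := charFun_map_of_adjoint (P := P) hN (L := K) t.ofLp.1 (J t.ofLp.1)
      fun w => hKt w _
    have h2 := charFun_map_of_adjoint (P := P) hN (L := L) t.ofLp.2 (L t.ofLp.2)
      fun w => hLt w _
    have h3 := charFun_map_of_adjoint (P := P) hN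
      (L := (WithLp.prodContinuousLinearEquiv 2 ℝ F E).symm.toContinuousLinearMap.comp (K.prod L))
      t (J t.ofLp.1 + L t.ofLp.2) fun w => by
        simp [WithLp.prod_inner_apply, hKt, hLt, inner_add_right]
    have e2 : (fun ω => N ω - J (K (N ω))) = fun ω => L (N ω) := by ext ω; simp [hL]
    rw [e2, h1, h2]
    refine h3.trans ?_
    -- The frequencies seen by the two components are orthogonal, so Pythagoras splits the exponent.
    rw [hchar, hchar, hchar, ← Complex.exp_add]
    have hn := norm_add_sq_eq_norm_sq_add_norm_sq_real (horth t.ofLp.1 t.ofLp.2)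
    congr 1
    have hn' : (‖J t.ofLp.1 + L t.ofLp.2‖ : ℂ) ^ 2 = ‖J t.ofLp.1‖ ^ 2 + ‖L t.ofLp.2‖ ^ 2 := by
      rw [sq, sq, sq]; exact_mod_cast hn
    rw [hn']
    ring
  -- The mean `m` only shifts both components by constants.
  have h := key.comp (φ := fun x => K m + x) (ψ := fun y => m - J (K m) + y)
    (by fun_prop) (by fun_prop)
  convert h using 1
  · ext ω; simp [hW]
  · ext ω; simp only [Function.comp, hW, map_add]; abel

theorem map_inv_smul_proj_eq_stdGaussian {P : Measure Ω} [IsProbabilityMeasure P] {σ : ℝ}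
    (hσ : 0 < σ) {N W : Ω → E} {m : E} (hN : Measurable N)
    (hchar : ∀ t, charFun (P.map N) t = Complex.exp (-(σ ^ 2 * ‖t‖ ^ 2 / 2)))
    {J : F →L[ℝ] E} {K : E →L[ℝ] F} (hJK : ∀ x w, inner ℝ (J x) w = inner ℝ x (K w))
    (hKJ : ∀ x, K (J x) = x) (hW : ∀ ω, W ω = m + N ω) (hm : K m = 0) :
    P.map (fun ω => σ⁻¹ • K (W ω)) = stdGaussian F := by
  have hKW : (fun ω => σ⁻¹ • K (W ω)) = fun ω => (σ⁻¹ • K) (N ω) := by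
    ext ω; simp [hW, hm]
  have : IsProbabilityMeasure (P.map fun ω => (σ⁻¹ • K) (N ω)) :=
    Measure.isProbabilityMeasure_map (by fun_prop)
  rw [hKW]
  refine Measure.ext_of_charFun (funext fun t => ?_)
  rw [charFun_map_of_adjoint hN t (σ⁻¹ • J t) fun w => by
    simp [inner_smul_left, inner_smul_right, real_inner_comm, ← hJK], hchar, charFun_stdGaussian]
  have hJ : ‖J t‖ ^ 2 = ‖t‖ ^ 2 := by
    rw [← real_inner_self_eq_norm_sq, hJK, hKJ, real_inner_self_eq_norm_sq]
  have hn : σ ^ 2 * ‖σ⁻¹ • J t‖ ^ 2 = ‖t‖ ^ 2 := by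
    rw [norm_smul, mul_pow, hJ, Real.norm_eq_abs, sq_abs]
    field_simp
  congr 1
  rw [neg_div]
  exact_mod_cast congrArg (fun r : ℝ => (((-(r / 2)) : ℝ) : ℂ)) hn

end

/-! ### Stacked vectors and the salient region -/

section

variable {n : ℕ}

theorem measurable_stack {Ω : Type*} [MeasurableSpace Ω] {x y : Ω → Input n} (hx : Measurable x)
    (hy : Measurable y) : Measurable fun ω => stack (x ω) (y ω) := by
  refine (WithLp.measurable_toLp 2 _).comp (measurable_pi_lambda _ ?_)
  rintro (i | i) <;> simp only [Sum.elim_inl, Sum.elim_inr] <;> fun_prop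

theorem measurable_queryPart : Measurable (queryPart : Stacked n → Input n) := by
  unfold queryPart
  fun_prop

theorem queryPart_add_smul (a b : Stacked n) (z : ℝ) :
    queryPart (a + z • b) = queryPart a + z • queryPart b := by
  ext i; simp [queryPart]

theorem queryPart_stack (x y : Input n) : queryPart (stack x y) = x := by
  ext i; simp [queryPart, stack]

theorem stack_add (x x' y y' : Input n) : stack (x + x') (y + y') = stack x y + stack x' y' := by
  ext (i | i) <;> simp [stack]

theorem measurableSet_salientRegion_eq {A : Input n → Input n} (hA : Measurable A) (τ : ℝ)
    (M : Finset (Fin n)) : MeasurableSet {x | salientRegion A τ x = M} := by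
  have h : {x | salientRegion A τ x = M} = ⋂ i, {x | τ ≤ A x i ↔ i ∈ M} := by
    ext x
    simp [salientRegion, Finset.ext_iff]
  rw [h]
  refine MeasurableSet.iInter fun i => ?_
  have hi : MeasurableSet {x | τ ≤ A x i} := measurableSet_le measurable_const (by fun_prop)
  by_cases hM : i ∈ M
  · simpa [hM] using hi
  · have : {x | τ ≤ A x i ↔ i ∈ M} = {x | τ ≤ A x i}ᶜ := by ext x; simp [hM]
    exact this ▸ hi.compl

/-- The stacked noise is centred Gaussian with covariance `σ² I` on `ℝ²ⁿ`. -/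
theorem charFun_map_stack {Ω : Type*} [MeasurableSpace Ω] {P : Measure Ω} [IsProbabilityMeasure P]
    {σ : ℝ} {ε εref : Ω → Input n} (hε_meas : Measurable ε) (hεref_meas : Measurable εref)
    (hε : P.map ε = multivariateGaussian 0 (σ ^ 2 • (1 : Matrix (Fin n) (Fin n) ℝ)))
    (hεref : P.map εref = multivariateGaussian 0 (σ ^ 2 • (1 : Matrix (Fin n) (Fin n) ℝ)))
    (hindep : IndepFun ε εref P) (t : Stacked n) :
    charFun (P.map fun ω => stack (ε ω) (εref ω)) t =
      Complex.exp (-(σ ^ 2 * ‖t‖ ^ 2 / 2)) := by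
  have hS : (σ ^ 2 • (1 : Matrix (Fin n) (Fin n) ℝ)).PosSemidef :=
    Matrix.PosSemidef.one.smul (sq_nonneg σ)
  have hG : ∀ u : Input n,
      charFun (multivariateGaussian 0 (σ ^ 2 • (1 : Matrix (Fin n) (Fin n) ℝ))) u =
        Complex.exp (-(σ ^ 2 * ‖u‖ ^ 2 / 2)) := fun u => by
    rw [charFun_multivariateGaussian hS, Matrix.smul_mulVec, Matrix.one_mulVec, dotProduct_smul,
      ← Complex.ofReal_pow ‖u‖, EuclideanSpace.real_norm_sq_eq]
    simp [dotProduct, ← sq]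
  set r : Input n := WithLp.toLp 2 fun i => t (Sum.inr i) with hr
  have hinner : ∀ x y : Input n, inner ℝ (stack x y) t = inner ℝ x (queryPart t) + inner ℝ y r :=
    fun x y => by simp [PiLp.inner_apply, stack, queryPart, hr]
  have h := (indepFun_iff_charFun_prod hε_meas.aemeasurable hεref_meas.aemeasurable).1 hindep
    (WithLp.toLp 2 (queryPart t, r))
  rw [hε, hεref, hG, hG, ← Complex.exp_add, charFun_apply, integral_map (by fun_prop)
    (by fun_prop)] at h
  rw [charFun_apply, integral_map (measurable_stack hε_meas hεref_meas).aemeasurable (by fun_prop)]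
  simp_rw [hinner]
  refine Eq.trans ?_ (h.trans ?_)
  · simp [WithLp.prod_inner_apply]
  · have hn : ‖t‖ ^ 2 = ‖queryPart t‖ ^ 2 + ‖r‖ ^ 2 := by
      simp [EuclideanSpace.real_norm_sq_eq, queryPart, hr]
    rw [← Complex.ofReal_pow ‖t‖, hn]
    push_cast
    congr 1
    ring

/-! ### The contrast `η_M` -/

theorem linStat_apply (M : Finset (Fin n)) (w : Stacked n) :
    linStat M w = (1 / (M.card : ℝ)) * ∑ i ∈ M, w (Sum.inl i) -
      (1 / (M.card : ℝ)) * ∑ i ∈ M, w (Sum.inr i) := by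
  simp [linStat, eta, PiLp.inner_apply, Finset.sum_ite_mem, Finset.mul_sum, mul_comm,
    sub_eq_add_neg]

theorem linStat_stack_eq_zero {s sref : Input n} {M : Finset (Fin n)} (h : MeanNull s sref M) :
    linStat M (stack s sref) = 0 := by
  rw [linStat_apply, sub_eq_zero]
  exact h

theorem eta_ne_zero {M : Finset (Fin n)} (hM : M.Nonempty) : eta M ≠ 0 := by
  obtain ⟨i, hi⟩ := hM
  intro h
  have := congrArg (fun w : Stacked n => w (Sum.inl i)) h
  simp [eta, hi] at this
  exact (Finset.ne_empty_of_mem hi) this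

/-- The line `a + z b` of the mean null test passes through `w` at the value `z = T` of the statistic. -/
theorem linNuisance_add_linStat_smul {M : Finset (Fin n)} (w : Stacked n) :
    linNuisance M w + linStat M w • ((1 / ‖eta M‖ ^ 2) • eta M) = w := by
  rw [linNuisance, linStat, smul_smul, mul_one_div, sub_add_cancel]

theorem stdGaussian_real : stdGaussian ℝ = gaussianReal 0 1 := by
  refine Measure.ext_of_charFun (funext fun t => ?_)
  rw [charFun_stdGaussian, charFun_gaussianReal]
  simp [← Complex.ofReal_pow, neg_div]

/-! ### The range of `P_M` -/

/-- The isometric embedding `x ↦ (x; -x) / √2` of `ℝ^M` into `ℝ²ⁿ`, extended by zero outside `M`; its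
range is the range of `P_M`. -/
noncomputable def diffEmbedding (M : Finset (Fin n)) : EuclideanSpace ℝ M →L[ℝ] Stacked n :=
  LinearMap.toContinuousLinearMap
    { toFun x := WithLp.toLp 2 (Sum.elim
        (fun i => if h : i ∈ M then x ⟨i, h⟩ / √2 else 0)
        (fun i => if h : i ∈ M then -(x ⟨i, h⟩ / √2) else 0))
      map_add' x y := by
        ext (i | i) <;> by_cases h : i ∈ M <;> simp [h] <;> ring
      map_smul' c x := by
        ext (i | i) <;> by_cases h : i ∈ M <;> simp [h] <;> ring }

/-- The normalized differences `(w_i - w_{n+i}) / √2` for `i ∈ M`; the adjoint of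
`diffEmbedding M`. -/
noncomputable def diffCoord (M : Finset (Fin n)) : Stacked n →L[ℝ] EuclideanSpace ℝ M :=
  LinearMap.toContinuousLinearMap
    { toFun w := WithLp.toLp 2 fun i => (w (Sum.inl i) - w (Sum.inr i)) / √2
      map_add' w w' := by ext i; simp; ring
      map_smul' c w := by ext i; simp; ring }

theorem diffEmbedding_inl (M : Finset (Fin n)) (x : EuclideanSpace ℝ M) (i : Fin n) :
    diffEmbedding M x (Sum.inl i) = if h : i ∈ M then x ⟨i, h⟩ / √2 else 0 := rfl

theorem diffEmbedding_inr (M : Finset (Fin n)) (x : EuclideanSpace ℝ M) (i : Fin n) :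
    diffEmbedding M x (Sum.inr i) = if h : i ∈ M then -(x ⟨i, h⟩ / √2) else 0 := rfl

theorem diffCoord_apply (M : Finset (Fin n)) (w : Stacked n) (i : M) :
    diffCoord M w i = (w (Sum.inl i) - w (Sum.inr i)) / √2 := rfl

theorem diffCoord_diffEmbedding (M : Finset (Fin n)) (x : EuclideanSpace ℝ M) :
    diffCoord M (diffEmbedding M x) = x := by
  ext i
  simp only [diffCoord_apply, diffEmbedding_inl, diffEmbedding_inr, i.2, dite_true, Subtype.coe_eta]
  rw [sub_neg_eq_add, ← add_div, div_div, Real.mul_self_sqrt zero_le_two]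
  ring

theorem inner_diffEmbedding (M : Finset (Fin n)) (x : EuclideanSpace ℝ M) (w : Stacked n) :
    inner ℝ (diffEmbedding M x) w = inner ℝ x (diffCoord M w) := by
  simp only [PiLp.inner_apply, Fintype.sum_sum_type, diffEmbedding_inl, diffEmbedding_inr,
    diffCoord_apply, ← Finset.sum_add_distrib]
  rw [Finset.univ_eq_attach, ← Finset.sum_subset (Finset.subset_univ M), ← Finset.sum_attach M]
  · refine Finset.sum_congr rfl fun i _ => ?_
    simp
    ring
  · intro i _ hi
    simp [hi]

theorem diffEmbedding_diffCoord (M : Finset (Fin n)) (w : Stacked n) :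
    diffEmbedding M (diffCoord M w) = proj M w := by
  have h2 : ∀ a : ℝ, a / √2 / √2 = a / 2 := fun a => by
    rw [div_div, Real.mul_self_sqrt zero_le_two]
  ext (i | i) <;> by_cases h : i ∈ M <;>
    simp [diffEmbedding_inl, diffEmbedding_inr, diffCoord_apply, proj, projMatrix, h, h2,
      Matrix.fromBlocks_mulVec, Matrix.mulVec_diagonal] <;> ring

theorem norm_proj (M : Finset (Fin n)) (w : Stacked n) : ‖proj M w‖ = ‖diffCoord M w‖ := by
  rw [← diffEmbedding_diffCoord, ← sq_eq_sq₀ (norm_nonneg _) (norm_nonneg _),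
    ← real_inner_self_eq_norm_sq, inner_diffEmbedding, diffCoord_diffEmbedding,
    real_inner_self_eq_norm_sq]

theorem diffCoord_stack_eq_zero {s sref : Input n} {M : Finset (Fin n)}
    (h : GlobalNull s sref M) : diffCoord M (stack s sref) = 0 := by
  ext i
  simp [diffCoord_apply, stack, h i i.2]

/-- The `χ` law with `|M|` degrees of freedom can be computed on `ℝ^M`, since the standard Gaussian law
is invariant under isometries. -/
theorem chi_card (M : Finset (Fin n)) :
    chi M.card = (stdGaussian (EuclideanSpace ℝ M)).map fun z => ‖z‖ := by
  have h := stdGaussian_map (LinearIsometryEquiv.piLpCongrLeft 2 ℝ ℝ M.equivFin)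
  rw [chi, ← h, Measure.map_map (by fun_prop) (by fun_prop)]
  congr 1
  ext z
  simp

theorem nullSingletonClass_map_norm {E : Type*} [NormedAddCommGroup E] [InnerProductSpace ℝ E]
    [FiniteDimensional ℝ E] [MeasurableSpace E] [BorelSpace E] [Nontrivial E] :
    NullSingletonClass ((stdGaussian E).map fun z => ‖z‖) := by
  refine ⟨fun c => ?_⟩
  rw [Measure.map_apply measurable_norm (measurableSet_singleton c)]
  refine stdGaussian_absolutelyContinuous ?_
  convert Measure.addHaar_sphere (volume : Measure E) 0 c using 2
  ext z; simp

end

/-! ### Laws of the two statistics for a fixed region -/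

section

variable {n : ℕ} {Ω : Type*} [MeasurableSpace Ω] {P : Measure Ω} [IsProbabilityMeasure P]
  {σ : ℝ} {N W : Ω → Stacked n} {m : Stacked n} {M : Finset (Fin n)}

theorem inner_toSpanSingleton (v : Stacked n) (x : ℝ) (w : Stacked n) :
    inner ℝ (ContinuousLinearMap.toSpanSingleton ℝ v x) w = inner ℝ x (innerSL ℝ v w) := by
  simp [inner_smul_left, mul_comm]

theorem innerSL_toSpanSingleton {v : Stacked n} (hv : ‖v‖ = 1) (x : ℝ) :
    innerSL ℝ v (ContinuousLinearMap.toSpanSingleton ℝ v x) = x := by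
  simp [hv]

theorem norm_mul_innerSL_normalized_eta (hM : M.Nonempty) (w : Stacked n) :
    ‖eta M‖ * innerSL ℝ (‖eta M‖⁻¹ • eta M) w = linStat M w := by
  have hη := norm_ne_zero_iff.2 (eta_ne_zero hM)
  rw [linStat, innerSL_apply_apply, real_inner_smul_left, mul_inv_cancel_left₀ hη]

theorem norm_normalized_eta (hM : M.Nonempty) : ‖‖eta M‖⁻¹ • eta M‖ = 1 := by
  have hη := norm_ne_zero_iff.2 (eta_ne_zero hM)
  rw [norm_smul, norm_inv, norm_norm, inv_mul_cancel₀ hη]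

theorem indepFun_linNuisance_linStat (hM : M.Nonempty) (hN : Measurable N)
    (hchar : ∀ t, charFun (P.map N) t = Complex.exp (-(σ ^ 2 * ‖t‖ ^ 2 / 2)))
    (hW : ∀ ω, W ω = m + N ω) :
    IndepFun (fun ω => linNuisance M (W ω)) (fun ω => linStat M (W ω)) P := by
  have h := (indepFun_proj_residual hN hchar (inner_toSpanSingleton (‖eta M‖⁻¹ • eta M))
    (innerSL_toSpanSingleton (norm_normalized_eta hM)) hW).symm.comp (φ := id)
    (ψ := fun x => ‖eta M‖ * x) measurable_id (by fun_prop)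
  convert h using 1
  · ext1 ω
    simp only [Function.comp, id, linNuisance, ContinuousLinearMap.toSpanSingleton_apply,
      innerSL_apply_apply, real_inner_smul_left, smul_smul]
    congr 2
    ring
  · ext1 ω
    exact (norm_mul_innerSL_normalized_eta hM _).symm

theorem map_linStat_eq_gaussianReal (hσ : 0 < σ) (hM : M.Nonempty) (hN : Measurable N)
    (hchar : ∀ t, charFun (P.map N) t = Complex.exp (-(σ ^ 2 * ‖t‖ ^ 2 / 2)))
    (hW : ∀ ω, W ω = m + N ω) (hm : linStat M m = 0) :
    P.map (fun ω => linStat M (W ω)) = gaussianReal 0 (σ ^ 2 * ‖eta M‖ ^ 2).toNNReal := by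
  have hWm : Measurable W := by rw [funext hW]; fun_prop
  have hη := norm_ne_zero_iff.2 (eta_ne_zero hM)
  have hm' : innerSL ℝ (‖eta M‖⁻¹ • eta M) m = 0 := by
    rw [← norm_mul_innerSL_normalized_eta hM] at hm
    exact (mul_eq_zero.1 hm).resolve_left hη
  have hT : (fun ω => linStat M (W ω)) = (fun x => σ * ‖eta M‖ * x) ∘
      fun ω => σ⁻¹ • innerSL ℝ (‖eta M‖⁻¹ • eta M) (W ω) := by
    ext1 ω
    have hσ' := hσ.ne'
    rw [← norm_mul_innerSL_normalized_eta hM, Function.comp, smul_eq_mul]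
    field_simp
  rw [hT, ← Measure.map_map (by fun_prop) (by fun_prop),
    map_inv_smul_proj_eq_stdGaussian hσ hN hchar (inner_toSpanSingleton (‖eta M‖⁻¹ • eta M))
      (innerSL_toSpanSingleton (norm_normalized_eta hM)) hW hm', stdGaussian_real,
    gaussianReal_map_const_mul, mul_zero]
  congr 1
  rw [← NNReal.coe_inj, Real.coe_toNNReal _ (by positivity)]
  simp [mul_pow]

theorem map_norm_proj_eq_chi (hσ : 0 < σ) (hN : Measurable N)
    (hchar : ∀ t, charFun (P.map N) t = Complex.exp (-(σ ^ 2 * ‖t‖ ^ 2 / 2)))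
    (hW : ∀ ω, W ω = m + N ω) (hm : diffCoord M m = 0) :
    P.map (fun ω => σ⁻¹ * ‖proj M (W ω)‖) = chi M.card := by
  have hWm : Measurable W := by rw [funext hW]; fun_prop
  have h := map_inv_smul_proj_eq_stdGaussian hσ hN hchar (inner_diffEmbedding M)
    (diffCoord_diffEmbedding M) hW hm
  rw [chi_card, ← h, Measure.map_map (by fun_prop) (by fun_prop)]
  congr 1 with ω
  simp [norm_proj, norm_smul, abs_of_pos hσ]

theorem measurable_proj : Measurable (proj M) := by
  unfold proj
  fun_prop

/-- The line `U + z V` passes through `w` at `z = T`; when `P_M w = 0` the junk value of `V` is `0`, and the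
identity persists. -/
theorem sub_proj_add_norm_smul_direction (hσ : 0 < σ) (w : Stacked n) :
    w - proj M w + (σ⁻¹ * ‖proj M w‖) • ((σ / ‖proj M w‖) • proj M w) = w := by
  by_cases hz : proj M w = 0
  · simp [hz]
  · have hz' : ‖proj M w‖ ≠ 0 := norm_ne_zero_iff.2 hz
    have hσ' := hσ.ne'
    rw [smul_smul, show σ⁻¹ * ‖proj M w‖ * (σ / ‖proj M w‖) = 1 by field_simp, one_smul,
      sub_add_cancel]

/-- The direction and the residual are jointly independent of the norm: the residual is independent
of the whole vector `P_M W`, and the direction of `P_M W` is independent of its norm. -/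
theorem indepFun_globalNuisance_norm_proj (hσ : 0 < σ) (hM : M.Nonempty) (hN : Measurable N)
    (hchar : ∀ t, charFun (P.map N) t = Complex.exp (-(σ ^ 2 * ‖t‖ ^ 2 / 2)))
    (hW : ∀ ω, W ω = m + N ω) (hm : diffCoord M m = 0) :
    IndepFun (fun ω => ((σ / ‖proj M (W ω)‖) • proj M (W ω), W ω - proj M (W ω)))
      (fun ω => σ⁻¹ * ‖proj M (W ω)‖) P := by
  have hWm : Measurable W := by rw [funext hW]; fun_prop
  have : Nonempty M := hM.to_subtype
  have hres := indepFun_proj_residual hN hchar (inner_diffEmbedding M)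
    (diffCoord_diffEmbedding M) hW
  have hlaw := map_inv_smul_proj_eq_stdGaussian hσ hN hchar (inner_diffEmbedding M)
    (diffCoord_diffEmbedding M) hW hm
  simp only [diffEmbedding_diffCoord] at hres
  -- `D` is standard Gaussian on `ℝ^M`, and `P_M W = σ J D`.
  set D := fun ω => σ⁻¹ • diffCoord M (W ω) with hD
  have hDm : Measurable D := by fun_prop
  have hnd := indepFun_norm_direction (E := EuclideanSpace ℝ M)
  rw [← hlaw, indepFun_iff_map_prod_eq_prod_map_map (by fun_prop) (by fun_prop),
    Measure.map_map (by fun_prop) hDm, Measure.map_map (by fun_prop) hDm,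
    Measure.map_map (by fun_prop) hDm] at hnd
  have hnd' := (indepFun_iff_map_prod_eq_prod_map_map (μ := P)
    (f := (fun x => ‖x‖) ∘ D) (g := (fun x => ‖x‖⁻¹ • x) ∘ D) (by fun_prop) (by fun_prop)).2 hnd
  have hDU : IndepFun (fun ω => (((fun x => ‖x‖) ∘ D) ω, ((fun x => ‖x‖⁻¹ • x) ∘ D) ω))
      (fun ω => W ω - proj M (W ω)) P :=
    hres.comp (φ := fun x => (‖σ⁻¹ • x‖, ‖σ⁻¹ • x‖⁻¹ • (σ⁻¹ • x))) (ψ := id)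
      (by fun_prop) measurable_id
  have hPW : Measurable fun ω => proj M (W ω) := measurable_proj.comp hWm
  have h3 := indepFun_prodMk_right (by fun_prop) (by fun_prop) (by fun_prop) hnd' hDU
  have h4 := h3.symm.comp (φ := fun p : EuclideanSpace ℝ M × Stacked n =>
    (σ • diffEmbedding M p.1, p.2)) (ψ := id) (by fun_prop) measurable_id
  convert h4 using 1
  · ext1 ω
    have hn : ‖D ω‖ = σ⁻¹ * ‖proj M (W ω)‖ := by
      simp [hD, norm_proj, norm_smul, abs_of_pos hσ]
    simp only [Function.comp, hn]
    simp only [hD, map_smul, diffEmbedding_diffCoord, smul_smul]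
    congr 2
    field_simp
  · ext1 ω
    simp [hD, norm_proj, norm_smul, abs_of_pos hσ]

theorem measurableSet_truncationRegion {A : Input n → Input n} (hA : Measurable A) (τ : ℝ)
    (M : Finset (Fin n)) {β : Type*} [MeasurableSpace β] {a b : β → Stacked n} (ha : Measurable a)
    (hb : Measurable b) :
    MeasurableSet {p : β × ℝ | p.2 ∈ truncationRegion A τ M (a p.1) (b p.1)} := by
  have hline : Measurable fun p : β × ℝ => queryPart (a p.1) + p.2 • queryPart (b p.1) :=
    (measurable_queryPart.comp (ha.comp measurable_fst)).add
      (measurable_snd.smul (measurable_queryPart.comp (hb.comp measurable_fst)))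
  exact hline (measurableSet_salientRegion_eq hA τ M)

theorem salientRegion_eq_iff_mem_truncationRegion {A : Input n → Input n} {τ : ℝ}
    {a b : Stacked n} {z : ℝ} {x y : Input n} (h : a + z • b = stack x y) :
    salientRegion A τ x = M ↔ z ∈ truncationRegion A τ M a b := by
  rw [truncationRegion, Set.mem_ofPred_eq, ← queryPart_add_smul, h, queryPart_stack]

end

end SelectiveInference

open SelectiveInference

theorem mainTheorem1 {Ω : Type*} [MeasurableSpace Ω] (P : Measure Ω) [IsProbabilityMeasure P]
    {n : ℕ} (σ : ℝ) (hσ : 0 < σ)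
    -- signals, noises, and the query and reference inputs
    (s sref : Input n) (ε εref X Xref : Ω → Input n)
    (hε_meas : Measurable ε) (hεref_meas : Measurable εref)
    (hε : P.map ε = multivariateGaussian 0 (σ ^ 2 • (1 : Matrix (Fin n) (Fin n) ℝ)))
    (hεref : P.map εref = multivariateGaussian 0 (σ ^ 2 • (1 : Matrix (Fin n) (Fin n) ℝ)))
    (hindep : IndepFun ε εref P)
    (hX : ∀ ω, X ω = s + ε ω) (hXref : ∀ ω, Xref ω = sref + εref ω)
    -- saliency method and threshold
    (A : Input n → Input n) (hA : Measurable A) (τ : ℝ)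
    -- the observed salient region
    (M : Finset (Fin n)) (hM : M.Nonempty)
    (hpos : P {ω | regionRV A τ X ω = M} ≠ 0) :
    -- mean null test
    (MeanNull s sref M →
      (∀ᵐ ω ∂(selectedLaw P (regionRV A τ X) M),
        selectiveLaw P (regionRV A τ X) (meanT A τ X Xref) (meanQ A τ X Xref) M
            (meanQ A τ X Xref ω) =
          ProbabilityTheory.cond (gaussianReal 0 (σ ^ 2 * ‖eta M‖ ^ 2).toNNReal)
            (truncationRegion A τ M (meanQ A τ X Xref ω) ((1 / ‖eta M‖ ^ 2) • eta M))) ∧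
      ∀ α : ℝ, 0 ≤ α → α ≤ 1 →
        selectedLaw P (regionRV A τ X) M
          {ω | selectivePValue P (regionRV A τ X) (meanT A τ X Xref) (meanQ A τ X Xref) ω ≤ α} =
            ENNReal.ofReal α) ∧
    -- global null test
    (GlobalNull s sref M →
      (∀ᵐ ω ∂(selectedLaw P (regionRV A τ X) M),
        selectiveLaw P (regionRV A τ X) (globalT σ A τ X Xref) (globalQ σ A τ X Xref) M
            (globalQ σ A τ X Xref ω) =
          ProbabilityTheory.cond (chi M.card)
            (truncationRegion A τ M (globalQ σ A τ X Xref ω).2 (globalQ σ A τ X Xref ω).1)) ∧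
      ∀ α : ℝ, 0 ≤ α → α ≤ 1 →
        selectedLaw P (regionRV A τ X) M
          {ω | selectivePValue P (regionRV A τ X) (globalT σ A τ X Xref)
            (globalQ σ A τ X Xref) ω ≤ α} = ENNReal.ofReal α) := by
  set N : Ω → Stacked n := fun ω => stack (ε ω) (εref ω) with hNdef
  set W : Ω → Stacked n := fun ω => stack (X ω) (Xref ω) with hWdef
  have hN : Measurable N := measurable_stack hε_meas hεref_meas
  have hchar := charFun_map_stack hε_meas hεref_meas hε hεref hindep
  have hW : ∀ ω, W ω = stack s sref + N ω := fun ω => by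
    simp only [hWdef, hNdef, hX, hXref, stack_add]
  have hWm : Measurable W := by rw [funext hW]; fun_prop
  constructor
  · intro h0
    have hm := linStat_stack_eq_zero h0
    have hν := map_linStat_eq_gaussianReal hσ hM hN hchar hW hm
    have : NullSingletonClass (gaussianReal 0 (σ ^ 2 * ‖eta M‖ ^ 2).toNNReal) := by
      refine nullSingletonClass_gaussianReal (Real.toNNReal_pos.2 ?_).ne'
      have := norm_pos_iff.2 (eta_ne_zero hM)
      positivity
    have hR : ∀ ω, regionRV A τ X ω = M ↔ (linNuisance M (W ω), linStat M (W ω)) ∈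
        {p : Stacked n × ℝ | p.2 ∈ truncationRegion A τ M p.1 ((1 / ‖eta M‖ ^ 2) • eta M)} :=
      fun ω => salientRegion_eq_iff_mem_truncationRegion (linNuisance_add_linStat_smul (W ω))
    have hT : ∀ ω, regionRV A τ X ω = M → meanT A τ X Xref ω = linStat M (W ω) := by
      rintro ω rfl; rfl
    have hQ : ∀ ω, regionRV A τ X ω = M → meanQ A τ X Xref ω = linNuisance M (W ω) := by
      rintro ω rfl; rfl
    have hS : MeasurableSet
        {p : Stacked n × ℝ | p.2 ∈ truncationRegion A τ M p.1 ((1 / ‖eta M‖ ^ 2) • eta M)} :=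
      measurableSet_truncationRegion hA τ M (a := fun q : Stacked n => q)
        (b := fun _ => (1 / ‖eta M‖ ^ 2) • eta M) measurable_id measurable_const
    have hTm : Measurable fun ω => linStat M (W ω) := by unfold linStat; fun_prop
    have hQm : Measurable fun ω => linNuisance M (W ω) := by unfold linNuisance; fun_prop
    have key := truncated_law_and_uniform_pValue hS hTm hQm
      (indepFun_linNuisance_linStat hM hN hchar hW) hν hT hQ hR hpos
    exact key
  · intro h0
    have hm := diffCoord_stack_eq_zero h0
    have hν := map_norm_proj_eq_chi hσ hN hchar hW hm
    have hPW : Measurable fun ω => proj M (W ω) := measurable_proj.comp hWm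
    have : Nonempty M := hM.to_subtype
    have : NullSingletonClass (chi M.card) := by
      rw [chi_card]
      exact nullSingletonClass_map_norm
    have hR : ∀ ω, regionRV A τ X ω = M ↔
        (((σ / ‖proj M (W ω)‖) • proj M (W ω), W ω - proj M (W ω)), σ⁻¹ * ‖proj M (W ω)‖) ∈
          {p : (Stacked n × Stacked n) × ℝ | p.2 ∈ truncationRegion A τ M p.1.2 p.1.1} :=
      fun ω => salientRegion_eq_iff_mem_truncationRegion
        (sub_proj_add_norm_smul_direction hσ (W ω))
    have hT : ∀ ω, regionRV A τ X ω = M →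
        globalT σ A τ X Xref ω = σ⁻¹ * ‖proj M (W ω)‖ := by
      rintro ω rfl; rfl
    have hQ : ∀ ω, regionRV A τ X ω = M → globalQ σ A τ X Xref ω =
        ((σ / ‖proj M (W ω)‖) • proj M (W ω), W ω - proj M (W ω)) := by
      rintro ω rfl; rfl
    have hS : MeasurableSet
        {p : (Stacked n × Stacked n) × ℝ | p.2 ∈ truncationRegion A τ M p.1.2 p.1.1} :=
      measurableSet_truncationRegion hA τ M (a := fun q : Stacked n × Stacked n => q.2)
        (b := fun q => q.1) measurable_snd measurable_fst
    have key := truncated_law_and_uniform_pValue hS (by fun_prop) (by fun_prop)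
      (indepFun_globalNuisance_norm_proj hσ hM hN hchar hW hm) hν hT hQ hR hpos
    exact key
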